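/- **Theorem 1.** Let $\mathbb R^{n_1}$, $\mathbb R^{n_2}$ be equipped with arbitrary norms, and for a square matrix $A$ let $\mu(A)=\limsup_{h\to0^+}\frac{\|I+hA\|-1}{h}$ be the matrix measure of the induced norm. For $i=1,2$ let $H_i:\mathbb R^{n_i}\to\mathbb R$ be a $C^1$ switching function with $\nabla H_i\neq0$ on the switching surface $\{H_i=0\}$, and let $f_{1i}(\xi_1,\xi_2,t)\in\mathbb R^{n_1}$, $f_{2i}(\xi_1,\xi_2,t)\in\mathbb R^{n_2}$ be continuously differentiable in $(\xi_1,\xi_2)$ for each $t\ge0$. Consider the feedback interconnection of two bimodal switched systems $$\dot\xi_1=\begin{cases}f_{11}(\xi_1,\xi_2,t)& H_1(\xi_1)>0\\ f_{12}(\xi_1,\xi_2,t)& H_1(\xi_1)<0\end{cases}\qquad \dot\xi_2=\begin{cases}f_{21}(\xi_1,\xi_2,t)& H_2(\xi_2)>0\\ f_{22}(\xi_1,\xi_2,t)& H_2(\xi_2)<0\end{cases}$$ with solutions in the sense of Filippov: absolutely continuous functions that satisfy the equations for almost every time, where on the surface $H_i(\xi_i)=0$ the right-hand side of system $i$ may be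 any convex combination of $f_{i1}$ and $f_{i2}$. Assume that there are positive constants $p_i,q_i,\tilde k_i,\tilde m_i$ ($i=1,2$) such that, for all $\xi_1,\xi_2$ and all $t\ge0$: 1. $\mu\big(\frac{\partial f_{1i}}{\partial\xi_1}\big)\le-p_i$ in the closed region of mode $i$ of system I ($H_1(\xi_1)\ge0$ for $i=1$, $H_1(\xi_1)\le0$ for $i=2$), and $\mu\big(\frac{\partial f_{2i}}{\partial\xi_2}\big)\le-q_i$ in the closed region of mode $i$ of system II ($H_2(\xi_2)\ge0$ for $i=1$, $H_2(\xi_2)\le0$ for $i=2$); 2. $\mu\big[(f_{i1}-f_{i2})\nabla H_i(\xi_i)\big]=0$ whenever $H_i(\xi_i)=0$, for $i=1,2$; 3. $\big\|\frac{\partial f_{1i}}{\partial\xi_2}\big\|\le\tilde k_i$ and $\big\|\frac{\partial f_{2i}}{\partial\xi_1}\big\|\le\tilde m_i$ in the same closed regions of mode $i$ of system I and of system II, respectively. Put $\tilde k=\max(\tilde k_1,\tilde k_2)$, $\tilde m=\max(\tilde m_1,\tilde m_2)$, $p=\min(p_1,p_2)$, $q=\min(q_1,q_2)$. If $$\frac{\tilde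 k\,\tilde m}{p\,q}<1,$$ then the interconnected system is exponentially incrementally stable: there are constants $K,c>0$ such that any two solutions $\xi=(\xi_1,\xi_2)$ and $\eta=(\eta_1,\eta_2)$ that start at the same time $t_0\ge0$ satisfy $\|\xi(t)-\eta(t)\|\le Ke^{-c(t-t_0)}\|\xi(t_0)-\eta(t_0)\|$ for all $t\ge t_0$ at which both exist, where $\|(\xi_1,\xi_2)\|=\max(\|\xi_1\|,\|\xi_2\|)$. -/

import Mathlib

open Set Filter Topology MeasureTheory

section GeneralNotions

variable {E : Type*} [NormedAddCommGroup E] [NormedSpace ℝ E]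

/-- The matrix measure (logarithmic norm) of a linear operator `A`, induced by the norm of `E`:
`limsup_{h → 0⁺} (‖I + h A‖ - 1) / h`, with the operator norm. -/
noncomputable def matrixMeasure (A : E →L[ℝ] E) : ℝ :=
  limsup (fun h : ℝ => (‖ContinuousLinearMap.id ℝ E + h • A‖ - 1) / h) (𝓝[>] 0)

/-- The Filippov set of a bimodal piecewise smooth vector field at a point where the switching
function takes the value `h` and the two modes take the values `v₁` and `v₂`: mode 1 is active
where the switching function is positive, mode 2 where it is negative, and all convex
combinations of the two modes are admitted on the switching surface. -/
noncomputable def filippovSet (h : ℝ) (v₁ v₂ : E) : Set E :=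
  if 0 < h then {v₁} else if h < 0 then {v₂} else segment ℝ v₁ v₂

/-- `x` is a (Carathéodory) solution on `[a, b]` of the differential inclusion `ẋ ∈ 𝓕 t x`:
it is absolutely continuous and satisfies the inclusion at almost every time. -/
def IsSolutionOn (𝓕 : ℝ → E → Set E) (a b : ℝ) (x : ℝ → E) : Prop :=
  AbsolutelyContinuousOnInterval x a b ∧
    ∀ᵐ t ∂(volume.restrict (Icc a b)), ∃ v ∈ 𝓕 t (x t), HasDerivAt x v t

/-- Uniform global exponential incremental stability of `ẋ ∈ 𝓕 t x`, `t ≥ 0`: any two solutions,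
with arbitrary initial states, started at the same time `t₀ ≥ 0`, approach each other
exponentially for as long as both of them exist, with constants that depend neither on the
solutions nor on the initial time. -/
def ExpIncrementallyStable (𝓕 : ℝ → E → Set E) : Prop :=
  ∃ K > 0, ∃ c > 0, ∀ t₀ t₁ : ℝ, 0 ≤ t₀ → t₀ ≤ t₁ → ∀ x y : ℝ → E,
    IsSolutionOn 𝓕 t₀ t₁ x → IsSolutionOn 𝓕 t₀ t₁ y →
      ∀ t ∈ Icc t₀ t₁, ‖x t - y t‖ ≤ K * Real.exp (-c * (t - t₀)) * ‖x t₀ - y t₀‖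

end GeneralNotions

section Interconnection

variable {E₁ E₂ : Type*} [NormedAddCommGroup E₁] [NormedSpace ℝ E₁]
  [NormedAddCommGroup E₂] [NormedSpace ℝ E₂]

/-- The feedback interconnection, in the sense of Filippov, of the bimodal switched systems
`ξ̇₁ = f₁ᵢ(ξ₁, ξ₂, t)` and `ξ̇₂ = f₂ᵢ(ξ₁, ξ₂, t)`, `i = 1, 2`, where the active mode of system I is
given by the sign of `H₁ ξ₁` and that of system II by the sign of `H₂ ξ₂`. -/
noncomputable def feedbackInclusion (H₁ : E₁ → ℝ) (H₂ : E₂ → ℝ)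
    (f₁₁ f₁₂ : E₁ → E₂ → ℝ → E₁) (f₂₁ f₂₂ : E₁ → E₂ → ℝ → E₂) :
    ℝ → E₁ × E₂ → Set (E₁ × E₂) :=
  fun t ξ =>
    filippovSet (H₁ ξ.1) (f₁₁ ξ.1 ξ.2 t) (f₁₂ ξ.1 ξ.2 t) ×ˢ
      filippovSet (H₂ ξ.2) (f₂₁ ξ.1 ξ.2 t) (f₂₂ ξ.1 ξ.2 t)

/-- `H` is a continuously differentiable switching function whose zero set is a regular
hypersurface. -/
def IsSwitchingFunction {E : Type*} [NormedAddCommGroup E] [NormedSpace ℝ E] (H : E → ℝ) : Prop :=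
  ContDiff ℝ 1 H ∧ ∀ z, H z = 0 → fderiv ℝ H z ≠ 0

/-- At every time `t ≥ 0` the vector field is continuously differentiable in the joint state. -/
def IsSmoothMode {E : Type*} [NormedAddCommGroup E] [NormedSpace ℝ E]
    (f : E₁ → E₂ → ℝ → E) : Prop :=
  ∀ t, 0 ≤ t → ContDiff ℝ 1 (fun ξ : E₁ × E₂ => f ξ.1 ξ.2 t)

/-- The Jacobian of `f` with respect to the first state. -/
noncomputable def jac₁ {E : Type*} [NormedAddCommGroup E] [NormedSpace ℝ E]
    (f : E₁ → E₂ → ℝ → E) (ξ₁ : E₁) (ξ₂ : E₂) (t : ℝ) : E₁ →L[ℝ] E :=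
  fderiv ℝ (fun z => f z ξ₂ t) ξ₁

/-- The Jacobian of `f` with respect to the second state. -/
noncomputable def jac₂ {E : Type*} [NormedAddCommGroup E] [NormedSpace ℝ E]
    (f : E₁ → E₂ → ℝ → E) (ξ₁ : E₁) (ξ₂ : E₂) (t : ℝ) : E₂ →L[ℝ] E :=
  fderiv ℝ (fun z => f ξ₁ z t) ξ₂

/-- The rank-one operator `v ∇H(z)`, i.e. `w ↦ (∇H(z) w) v`. -/
noncomputable def jumpGrad {E : Type*} [NormedAddCommGroup E] [NormedSpace ℝ E]
    (H : E → ℝ) (z v : E) : E →L[ℝ] E :=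
  (fderiv ℝ H z).smulRight v

end Interconnection

/-! The estimate is a contraction argument with norming functionals (`IsNorming`): wherever the norm
of a difference of solutions is differentiable, its derivative is the value of any norming
functional on the difference of velocities. It therefore suffices to find, for each pair of states
at a fixed time, one norming functional `ψ` of `x - y` such that `ψ (a - b) ≤ -p ‖x - y‖ + k ‖x₀ -
y₀‖` for all Filippov velocities `a`, `b` (`exists_isNorming_filippov`).

Along the segment from `y` to `x`, the matrix measure bounds the growth of `ψ ∘ f` inside a mode,
and the jump condition makes `ψ ∘ f` drop at each transversal crossing (`antitone_of_transversal`).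
Segments touching the surface are avoided by a Sard-type argument: almost every translate is
transversal, and the inequality survives limits. Limits cannot always realise every pair of endpoint
modes; the exception is a direction tangent to the surface at `x`, where the jump is Birkhoff
orthogonal to `x - y` and `ψ` can be chosen to annihilate it.

The two resulting inequalities combine, under the small-gain condition, into exponential decay of
`‖x₁ - y₁‖ + β ‖x₂ - y₂‖`. -/

section Transversality

/-! ### Genericity of transversal lines -/

variable {E : Type*} [NormedAddCommGroup E] [NormedSpace ℝ E]

/-- The points of the hypersurface `{H = 0}` at which the direction `w` is tangent to it. -/
def tangencySet (H : E → ℝ) (w : E) : Set E := {z | H z = 0 ∧ fderiv ℝ H z w = 0}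

/-- The union of the lines with direction `w` through the points of `s`. -/
def lineSweep (s : Set E) (w : E) : Set E := {z | ∃ a ∈ s, ∃ r : ℝ, z = a + r • w}

theorem exists_apply_eq_one_of_ne_zero {L : E →L[ℝ] ℝ} (hL : L ≠ 0) : ∃ n, L n = 1 := by
  obtain ⟨v, hv⟩ : ∃ v, L v ≠ 0 := by
    by_contra! h
    exact hL (ContinuousLinearMap.ext h)
  exact ⟨(L v)⁻¹ • v, by simp [hv]⟩

theorem lineSweep_iUnion {ι : Type*} (s : Set ι) (f : ι → Set E) (w : E) :
    lineSweep (⋃ i ∈ s, f i) w = ⋃ i ∈ s, lineSweep (f i) w := by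
  ext z
  simp only [lineSweep, mem_iUnion, mem_ofPred_eq]
  constructor
  · rintro ⟨a, ⟨i, hi, ha⟩, r, rfl⟩
    exact ⟨i, hi, a, ha, r, rfl⟩
  · rintro ⟨i, hi, a, ha, r, rfl⟩
    exact ⟨a, ⟨i, hi, ha⟩, r, rfl⟩

variable [FiniteDimensional ℝ E]

/-- Locally, the lines that touch the regular hypersurface `{H = 0}` form a null set. -/
theorem exists_nhds_lineSweep_tangencySet_null [MeasurableSpace E] [BorelSpace E]
    (μ : Measure E) [μ.IsAddHaarMeasure] {H : E → ℝ} (hH : ContDiff ℝ 1 H) (w z₀ : E)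
    (hz₀ : fderiv ℝ H z₀ ≠ 0) :
    ∃ V ∈ 𝓝 z₀, μ (lineSweep (tangencySet H w ∩ V) w) = 0 := by
  obtain ⟨n, hn⟩ := exists_apply_eq_one_of_ne_zero hz₀
  set g := fderiv ℝ H z₀ with hg
  have hHd : ∀ z, HasFDerivAt H (fderiv ℝ H z) z := fun z =>
    (hH.differentiable (by simp) z).hasFDerivAt
  -- A straightening map: `g n = 1` gives `g ∘ Θ = H`, and its derivative at `z₀` is the identity,
  -- so the inverse function theorem applies.
  let Θ : E → E := fun z => z + (H z - g z) • n
  have hΘc : ContDiff ℝ 1 Θ := contDiff_id.add ((hH.sub g.contDiff).smul contDiff_const)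
  have hΘd : ∀ z, HasFDerivAt Θ
      (ContinuousLinearMap.id ℝ E + (fderiv ℝ H z - g).smulRight n) z := fun z =>
    (hasFDerivAt_id z).add (((hHd z).sub g.hasFDerivAt).smul_const n)
  have hΘ₀ : HasFDerivAt Θ ((ContinuousLinearEquiv.refl ℝ E : E ≃L[ℝ] E) : E →L[ℝ] E) z₀ := by
    convert hΘd z₀ using 1
    ext v
    simp [hg]
  have hgΘ : ∀ z, g (Θ z) = H z := fun z => by simp [Θ, hn]
  have hca : ContDiffAt ℝ 1 Θ z₀ := hΘc.contDiffAt
  let e := hca.toOpenPartialHomeomorph Θ hΘ₀ (by simp)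
  have heΘ : ∀ z, e z = Θ z := fun z => rfl
  have hmem : z₀ ∈ e.source := hca.mem_toOpenPartialHomeomorph_source hΘ₀ (by simp)
  have hinv : ContDiffAt ℝ 1 e.symm (Θ z₀) := hca.to_localInverse hΘ₀ (by simp)
  have hdiff : ∀ᶠ a in 𝓝 (Θ z₀), DifferentiableAt ℝ e.symm a :=
    (hinv.eventually (by simp)).mono fun a ha => ha.differentiableAt (by simp)
  have hdiff' : ∀ᶠ z in 𝓝 z₀, DifferentiableAt ℝ e.symm (Θ z) :=
    hΘc.continuous.continuousAt.eventually hdiff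
  refine ⟨{z | DifferentiableAt ℝ e.symm (Θ z)} ∩ e.source,
    inter_mem hdiff' (e.open_source.mem_nhds hmem), ?_⟩
  set V := {z | DifferentiableAt ℝ e.symm (Θ z)} ∩ e.source with hV
  -- A surface point `z` and a parameter `r` are encoded as `a = Θ z + r • n`; since `g (Θ z) = H z
  -- = 0`, `r = g a` and `Φ a = z + r • w`.
  let Φ : E → E := fun a => e.symm (a - g a • n) + g a • w
  let Φ' : E → E →L[ℝ] E := fun a =>
    (fderiv ℝ e.symm (a - g a • n)).comp (ContinuousLinearMap.id ℝ E - g.smulRight n) +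
      g.smulRight w
  let A : Set E := {a | ∃ z ∈ tangencySet H w ∩ V, ∃ r : ℝ, a = Θ z + r • n}
  have hA : ∀ z ∈ tangencySet H w ∩ V, ∀ r : ℝ, g (Θ z + r • n) = r := by
    intro z hz r
    rw [map_add, hgΘ, hz.1.1, map_smul, hn]; simp
  have hA' : ∀ z ∈ tangencySet H w ∩ V, ∀ r : ℝ,
      (Θ z + r • n) - g (Θ z + r • n) • n = Θ z := by
    intro z hz r
    rw [hA z hz r]; simp
  have hsub : lineSweep (tangencySet H w ∩ V) w ⊆ Φ '' A := by
    rintro _ ⟨z, hz, r, rfl⟩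
    refine ⟨Θ z + r • n, ⟨z, hz, r, rfl⟩, ?_⟩
    simp only [Φ]
    rw [hA' z hz r, hA z hz r, ← heΘ, e.left_inv hz.2.2]
  refine measure_mono_null hsub
    (addHaar_image_eq_zero_of_det_fderivWithin_eq_zero μ (f' := Φ') ?_ ?_)
  · rintro _ ⟨z, hz, r, rfl⟩
    have h1 : HasFDerivAt (fun a : E => a - g a • n)
        (ContinuousLinearMap.id ℝ E - g.smulRight n) (Θ z + r • n) :=
      (hasFDerivAt_id _).sub (g.hasFDerivAt.smul_const n)
    have h2 : HasFDerivAt e.symm (fderiv ℝ e.symm ((Θ z + r • n) - g (Θ z + r • n) • n))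
        ((Θ z + r • n) - g (Θ z + r • n) • n) := by
      rw [hA' z hz r]
      exact hz.2.1.hasFDerivAt
    have h3 : HasFDerivAt (fun a : E => g a • w) (g.smulRight w) (Θ z + r • n) :=
      g.hasFDerivAt.smul_const w
    exact ((HasFDerivAt.comp (f := fun a : E => a - g a • n) _ h2 h1).add h3).hasFDerivWithinAt
  · rintro _ ⟨z, hz, r, rfl⟩
    have hcomp : (fderiv ℝ e.symm (Θ z)).comp
        (ContinuousLinearMap.id ℝ E + (fderiv ℝ H z - g).smulRight n) =
          ContinuousLinearMap.id ℝ E := by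
      have h1 : HasFDerivAt (e.symm ∘ Θ) _ z := hz.2.1.hasFDerivAt.comp z (hΘd z)
      have h2 : e.symm ∘ Θ =ᶠ[𝓝 z] id := by
        filter_upwards [e.open_source.mem_nhds hz.2.2] with y hy
        exact e.left_inv hy
      exact h1.unique ((hasFDerivAt_id z).congr_of_eventuallyEq h2)
    have hw : fderiv ℝ e.symm (Θ z) (w - g w • n) = w := by
      have := congrArg (fun L : E →L[ℝ] E => L w) hcomp
      simpa [hz.1.2, sub_eq_add_neg] using this
    -- By tangency the derivative of `Θ` at `z` sends `w` to `w - g w • n`. Moving the base point in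
    -- that direction and moving along `n` both displace `Φ` by `w`, so the difference lies in the
    -- kernel.
    have hker : Φ' (Θ z + r • n) (w - g w • n - n) = 0 := by
      simp only [Φ', hA' z hz r]
      have : (w - g w • n - n) - g (w - g w • n - n) • n = w - g w • n := by
        simp [hn]
      simp only [add_apply, ContinuousLinearMap.comp_apply,
        sub_apply, ContinuousLinearMap.id_apply,
        ContinuousLinearMap.smulRight_apply, this, hw]
      simp [hn]
    have hne : w - g w • n - n ≠ 0 := by
      intro h
      have := congrArg g h
      simp [hn] at this
    exact LinearMap.det_eq_zero_iff_ker_ne_bot.2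
      ((Submodule.ne_bot_iff _).2 ⟨_, LinearMap.mem_ker.2 hker, hne⟩)

/-- The lines of a given direction that touch a regular hypersurface form a null set. -/
theorem lineSweep_tangencySet_null [MeasurableSpace E] [BorelSpace E]
    (μ : Measure E) [μ.IsAddHaarMeasure] {H : E → ℝ} (hH : IsSwitchingFunction H) (w : E) :
    μ (lineSweep (tangencySet H w) w) = 0 := by
  have : ∀ z : E, ∃ V : Set E, z ∈ tangencySet H w →
      V ∈ 𝓝 z ∧ μ (lineSweep (tangencySet H w ∩ V) w) = 0 := by
    intro z
    by_cases hz : z ∈ tangencySet H w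
    · obtain ⟨V, hV, hV'⟩ := exists_nhds_lineSweep_tangencySet_null μ hH.1 w z (hH.2 z hz.1)
      exact ⟨V, fun _ => ⟨hV, hV'⟩⟩
    · exact ⟨∅, fun h => absurd h hz⟩
  choose V hV using this
  have : ProperSpace E := FiniteDimensional.proper_real E
  obtain ⟨t, hts, htc, hcov⟩ := TopologicalSpace.countable_cover_nhdsWithin
    (f := V) (s := tangencySet H w) fun z hz => mem_nhdsWithin_of_mem_nhds (hV z hz).1
  have hsub : lineSweep (tangencySet H w) w ⊆
      ⋃ z ∈ t, lineSweep (tangencySet H w ∩ V z) w := by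
    rw [← lineSweep_iUnion, ← inter_iUnion₂, inter_eq_left.2 hcov]
  exact measure_mono_null hsub
    ((measure_biUnion_null_iff htc).2 fun z hz => (hV z (hts hz)).2)

/-- Almost all, hence densely many, translates of a line are transversal to a regular
hypersurface. -/
theorem dense_transversal_translates {H : E → ℝ} (hH : IsSwitchingFunction H) (y w : E) :
    Dense {u : E | ∀ s : ℝ, H (y + u + s • w) = 0 → fderiv ℝ H (y + u + s • w) w ≠ 0} := by
  borelize E
  have hnull := lineSweep_tangencySet_null (Measure.addHaar : Measure E) hH w
  have hnull' : (Measure.addHaar : Measure E)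
      ((fun u => y + u) ⁻¹' lineSweep (tangencySet H w) w) = 0 := by
    rw [measure_preimage_add]; exact hnull
  have hae : ∀ᵐ u ∂(Measure.addHaar : Measure E), y + u ∉ lineSweep (tangencySet H w) w :=
    compl_mem_ae_iff.2 hnull'
  have hd := Measure.dense_of_ae hae
  refine hd.mono ?_
  intro u hu s hs hs'
  exact hu ⟨y + u + s • w, ⟨hs, hs'⟩, -s, by simp⟩

end Transversality

/-! ### Norming functionals and the matrix measure -/

section Norming

variable {E : Type*} [NormedAddCommGroup E] [NormedSpace ℝ E]

/-- `ψ` is a functional of norm at most one that attains the norm of `w`. -/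
def IsNorming (ψ : E →L[ℝ] ℝ) (w : E) : Prop := ‖ψ‖ ≤ 1 ∧ ψ w = ‖w‖

theorem exists_isNorming (w : E) : ∃ ψ : E →L[ℝ] ℝ, IsNorming ψ w :=
  exists_dual_vector'' ℝ w

theorem IsNorming.apply_le {ψ : E →L[ℝ] ℝ} {w : E} (h : IsNorming ψ w) (x : E) : ψ x ≤ ‖x‖ :=
  (le_abs_self _).trans ((ψ.le_opNorm x).trans (by nlinarith [h.1, norm_nonneg x]))

/-- A bound on the matrix measure is a one-sided bound in the duality pairing. -/
theorem IsNorming.apply_le_of_matrixMeasure_le {A : E →L[ℝ] E} {c : ℝ} (hA : matrixMeasure A ≤ c)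
    {ψ : E →L[ℝ] ℝ} {w : E} (h : IsNorming ψ w) : ψ (A w) ≤ c * ‖w‖ := by
  -- Boundedness above lets an upper bound on the real `limsup` yield an eventual upper bound.
  have hb : IsBoundedUnder (· ≤ ·) (𝓝[>] (0 : ℝ))
      (fun h : ℝ => (‖ContinuousLinearMap.id ℝ E + h • A‖ - 1) / h) := by
    refine ⟨‖A‖, eventually_map.2 ?_⟩
    filter_upwards [self_mem_nhdsWithin] with r hr
    have hr : 0 < r := hr
    rw [div_le_iff₀ hr]
    have h1 := norm_add_le (ContinuousLinearMap.id ℝ E) (r • A)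
    have h2 : ‖r • A‖ = r * ‖A‖ := by rw [norm_smul, Real.norm_of_nonneg hr.le]
    have h3 := ContinuousLinearMap.norm_id_le (𝕜 := ℝ) (E := E)
    linarith
  refine le_of_forall_pos_le_add fun ε hε => ?_
  have hε' : 0 < ε / (‖w‖ + 1) := by positivity
  have hlt : matrixMeasure A < c + ε / (‖w‖ + 1) := by linarith
  obtain ⟨r, hr, hr0⟩ := ((eventually_lt_of_limsup_lt hlt hb).and
    (self_mem_nhdsWithin (a := (0 : ℝ)) (s := Ioi 0))).exists
  have hr0 : 0 < r := hr0
  rw [div_lt_iff₀ hr0] at hr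
  have h1 := h.apply_le ((ContinuousLinearMap.id ℝ E + r • A) w)
  have h2 := (ContinuousLinearMap.id ℝ E + r • A).le_opNorm w
  have h3 : ψ ((ContinuousLinearMap.id ℝ E + r • A) w) = ‖w‖ + r * ψ (A w) := by
    simp [h.2]
  have h4 : ‖ContinuousLinearMap.id ℝ E + r • A‖ * ‖w‖ ≤
      (1 + (c + ε / (‖w‖ + 1)) * r) * ‖w‖ :=
    mul_le_mul_of_nonneg_right (by linarith) (norm_nonneg w)
  have h5 : r * ψ (A w) ≤ r * ((c + ε / (‖w‖ + 1)) * ‖w‖) := by nlinarith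
  have h6 := le_of_mul_le_mul_left h5 hr0
  have h7 : ε / (‖w‖ + 1) * ‖w‖ ≤ ε := by
    rw [div_mul_eq_mul_div, div_le_iff₀ (by positivity)]
    nlinarith [norm_nonneg w]
  linarith

/-- If `w` is Birkhoff orthogonal to `d`, then some norming functional of `w` vanishes at `d`. -/
theorem exists_isNorming_apply_eq_zero {w d : E} (h : ∀ s : ℝ, ‖w‖ ≤ ‖w + s • d‖) :
    ∃ ψ : E →L[ℝ] ℝ, IsNorming ψ w ∧ ψ d = 0 := by
  let S : Submodule ℝ E := Submodule.span ℝ {d}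
  obtain ⟨g, hg, hgw⟩ := exists_dual_vector'' ℝ (S.mkQ w)
  have hmk : ∀ z : E, ‖S.mkQ z‖ ≤ ‖z‖ := fun z => Submodule.Quotient.norm_mk_le S z
  refine ⟨LinearMap.mkContinuous (g.toLinearMap.comp S.mkQ) 1 fun z => ?_, ⟨?_, ?_⟩, ?_⟩
  · exact (g.le_opNorm _).trans (mul_le_mul hg (hmk z) (norm_nonneg _) zero_le_one)
  · exact LinearMap.mkContinuous_norm_le _ zero_le_one _
  -- Birkhoff orthogonality says that passing to the quotient by the line of `d` does not shrink
  -- `w`; a norming functional of its class then pulls back.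
  · have : ‖S.mkQ w‖ = ‖w‖ := by
      refine le_antisymm (hmk w) ?_
      refine le_of_forall_pos_le_add fun ε hε => ?_
      obtain ⟨m, hm, hlt⟩ := Submodule.Quotient.norm_mk_lt (S := S) (S.mkQ w) hε
      have hmem : m - w ∈ S := (Submodule.Quotient.eq S).1 hm
      obtain ⟨s, hs⟩ := Submodule.mem_span_singleton.1 hmem
      have := h s
      rw [hs] at this
      simp only [add_sub_cancel] at this
      linarith
    exact hgw.trans this
  · have : S.mkQ d = 0 := 
      (Submodule.Quotient.mk_eq_zero S).2 (Submodule.mem_span_singleton_self d)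
    simp [this]

end Norming

/-! ### One-sided monotonicity -/

section Calculus

/-- Continuity is not needed, so downward jumps are allowed. The supremum of the points of `[a, b]`
where `φ` is at most `φ a` belongs to this set by the left condition, and equals `b` by the right
one. -/
theorem antitone_of_eventually_nhdsWithin {φ : ℝ → ℝ}
    (hl : ∀ s, ∀ᶠ r in 𝓝[<] s, φ s ≤ φ r) (hr : ∀ s, ∀ᶠ r in 𝓝[>] s, φ r ≤ φ s) :
    Antitone φ := by
  intro a b hab
  let S : Set ℝ := {s | s ∈ Icc a b ∧ φ s ≤ φ a}
  have haS : a ∈ S := ⟨⟨le_rfl, hab⟩, le_rfl⟩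
  have hbdd : BddAbove S := ⟨b, fun s hs => hs.1.2⟩
  have hσ : IsLUB S (sSup S) := isLUB_csSup ⟨a, haS⟩ hbdd
  set σ := sSup S
  have hσb : σ ≤ b := hσ.2 fun s hs => hs.1.2
  have haσ : a ≤ σ := hσ.1 haS
  have hφσ : φ σ ≤ φ a := by
    obtain ⟨l, hl1, hl2⟩ := mem_nhdsLT_iff_exists_Ioo_subset.1 (hl σ)
    obtain ⟨s, hs, hls, hsσ⟩ := hσ.exists_between hl1
    rcases hsσ.eq_or_lt with rfl | hlt
    · exact hs.2
    · exact (hl2 ⟨hls, hlt⟩ : φ σ ≤ φ s).trans hs.2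
  rcases hσb.eq_or_lt with h | h
  · rwa [h] at hφσ
  · obtain ⟨u, hu1, hu2⟩ := mem_nhdsGT_iff_exists_Ioo_subset.1 (hr σ)
    obtain ⟨s, hs1, hs2⟩ := exists_between (lt_min h hu1)
    have h1 : φ s ≤ φ σ := hu2 ⟨hs1, hs2.trans_le (min_le_right _ _)⟩
    have h2 : s ∈ S := ⟨⟨haσ.trans hs1.le, (hs2.trans_le (min_le_left _ _)).le⟩, h1.trans hφσ⟩
    exact absurd (hσ.1 h2) (not_le.2 hs1)

theorem HasDerivAt.eventually_sign_of_pos {h : ℝ → ℝ} {h' s : ℝ} (hd : HasDerivAt h h' s)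
    (hs : h s = 0) (hh : 0 < h') :
    (∀ᶠ r in 𝓝[>] s, 0 < h r) ∧ ∀ᶠ r in 𝓝[<] s, h r < 0 := by
  have ht := (hasDerivAt_iff_tendsto_slope.1 hd).eventually (lt_mem_nhds hh)
  constructor
  · filter_upwards [ht.filter_mono (nhdsWithin_mono s fun r (hr : s < r) => hr.ne'),
      self_mem_nhdsWithin] with r hr hsr
    have hsr : 0 < r - s := sub_pos.2 hsr
    rw [slope_def_field, hs, sub_zero] at hr
    exact (div_pos_iff_of_pos_right hsr).1 hr
  · filter_upwards [ht.filter_mono (nhdsWithin_mono s fun r (hr : r < s) => hr.ne),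
      self_mem_nhdsWithin] with r hr hsr
    have hsr : r - s < 0 := sub_neg.2 hsr
    rw [slope_def_field, hs, sub_zero] at hr
    by_contra hcon
    exact absurd hr (not_lt.2 (div_nonpos_of_nonneg_of_nonpos (not_lt.1 hcon) hsr.le))

end Calculus

/-- The sign of the switching function in the region of a mode. -/
def modeSign (i : Bool) : ℝ := if i then 1 else -1

theorem decide_eq_of_modeSign_mul_pos {i : Bool} {h : ℝ} (hi : 0 < modeSign i * h) :
    decide (0 < h) = i := by
  cases i
  · simp only [modeSign] at hi
    simp at hi ⊢
    exact hi.le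
  · simpa [modeSign] using hi

/-! ### Dissipativity along transversal segments -/

section SwitchedField

variable {E F : Type*} [NormedAddCommGroup E] [NormedSpace ℝ E]
  [NormedAddCommGroup F] [NormedSpace ℝ F]

/-- A bimodal switched vector field on `E` with input in `F` whose modes are dissipative on their
closed regions with rate `p` and input gain `k`, and whose jump is dissipative across the switching
surface. -/
structure IsDissipativeSwitched (H : E → ℝ) (f : Bool → E × F → E) (p k : ℝ) : Prop where
  switching : IsSwitchingFunction H
  smooth : ∀ i, ContDiff ℝ 1 (f i)
  rate : ∀ i x y w v (ψ : E →L[ℝ] ℝ), 0 ≤ modeSign i * H x → IsNorming ψ w →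
    ψ (fderiv ℝ (f i) (x, y) (w, v)) ≤ -p * ‖w‖ + k * ‖v‖
  jump : ∀ x y w (ψ : E →L[ℝ] ℝ), H x = 0 → IsNorming ψ w →
    fderiv ℝ H x w * ψ (f true (x, y) - f false (x, y)) ≤ 0

namespace IsDissipativeSwitched

variable {H : E → ℝ} {f : Bool → E × F → E} {p k : ℝ}

theorem hasDerivAt_switching (hS : IsDissipativeSwitched H f p k) (x w : E) (s : ℝ) :
    HasDerivAt (fun s : ℝ => H (x + s • w)) (fderiv ℝ H (x + s • w) w) s := by
  have h1 : HasDerivAt (fun s : ℝ => x + s • w) w s := by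
    simpa using ((hasDerivAt_id s).smul_const w).const_add x
  exact ((hS.switching.1.differentiable (by simp) _).hasFDerivAt).comp_hasDerivAt s h1

theorem segment_le (hS : IsDissipativeSwitched H f p k) {ψ : E →L[ℝ] ℝ} {w : E}
    (hψ : IsNorming ψ w) (x : E) (y v : F) (i : Bool) {a b : ℝ} (hab : a ≤ b)
    (hs : ∀ s ∈ Icc a b, 0 ≤ modeSign i * H (x + s • w)) :
    ψ (f i (x + b • w, y + b • v)) - ψ (f i (x + a • w, y + a • v)) ≤
      (-p * ‖w‖ + k * ‖v‖) * (b - a) := by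
  have hd : ∀ s : ℝ, HasDerivAt (fun s : ℝ => ψ (f i (x + s • w, y + s • v)))
      (ψ (fderiv ℝ (f i) (x + s • w, y + s • v) (w, v))) s := by
    intro s
    have h1 : HasDerivAt (fun s : ℝ => x + s • w) w s := by
      simpa using ((hasDerivAt_id s).smul_const w).const_add x
    have h2 : HasDerivAt (fun s : ℝ => y + s • v) v s := by
      simpa using ((hasDerivAt_id s).smul_const v).const_add y
    have h3 := ((hS.smooth i).differentiable (by simp)
      (x + s • w, y + s • v)).hasFDerivAt.comp_hasDerivAt s (h1.prodMk h2)
    exact ψ.hasFDerivAt.comp_hasDerivAt s h3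
  refine (convex_Icc a b).image_sub_le_mul_sub_of_deriv_le
    (fun s _ => (hd s).continuousAt.continuousWithinAt)
    (fun s _ => (hd s).differentiableAt.differentiableWithinAt) ?_
    a (left_mem_Icc.2 hab) b (right_mem_Icc.2 hab) hab
  intro s hs'
  rw [(hd s).deriv]
  exact hS.rate i _ _ w v ψ (hs s (interior_subset hs')) hψ

/-- Along a line transversal to the switching surface, the active mode is dissipative. -/
theorem antitone_of_transversal (hS : IsDissipativeSwitched H f p k) {ψ : E →L[ℝ] ℝ} {w : E}
    (hψ : IsNorming ψ w) (x : E) (y v : F)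
    (htr : ∀ s : ℝ, H (x + s • w) = 0 → fderiv ℝ H (x + s • w) w ≠ 0) :
    Antitone fun s : ℝ => ψ (f (decide (0 < H (x + s • w))) (x + s • w, y + s • v)) -
      (-p * ‖w‖ + k * ‖v‖) * s := by
  have hright : ∀ (i : Bool) (s : ℝ), 0 ≤ modeSign i * H (x + s • w) →
      (∀ᶠ r in 𝓝[>] s, 0 < modeSign i * H (x + r • w)) → ∀ᶠ r in 𝓝[>] s,
      decide (0 < H (x + r • w)) = i ∧
        ψ (f i (x + r • w, y + r • v)) - ψ (f i (x + s • w, y + s • v)) ≤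
          (-p * ‖w‖ + k * ‖v‖) * (r - s) := by
    intro i s h0 h1
    obtain ⟨u, hu, hsub⟩ := mem_nhdsGT_iff_exists_Ioo_subset.1 h1
    filter_upwards [Ioo_mem_nhdsGT hu] with r hr
    refine ⟨?_, hS.segment_le hψ x y v i hr.1.le fun q hq => ?_⟩
    · exact decide_eq_of_modeSign_mul_pos (hsub hr)
    · rcases hq.1.eq_or_lt with rfl | h
      · exact h0
      · exact le_of_lt (hsub ⟨h, hq.2.trans_lt hr.2⟩)
  have hleft : ∀ (i : Bool) (s : ℝ), 0 ≤ modeSign i * H (x + s • w) →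
      (∀ᶠ r in 𝓝[<] s, 0 < modeSign i * H (x + r • w)) → ∀ᶠ r in 𝓝[<] s,
      decide (0 < H (x + r • w)) = i ∧
        ψ (f i (x + s • w, y + s • v)) - ψ (f i (x + r • w, y + r • v)) ≤
          (-p * ‖w‖ + k * ‖v‖) * (s - r) := by
    intro i s h0 h1
    obtain ⟨u, hu, hsub⟩ := mem_nhdsLT_iff_exists_Ioo_subset.1 h1
    filter_upwards [Ioo_mem_nhdsLT hu] with r hr
    refine ⟨?_, hS.segment_le hψ x y v i hr.2.le fun q hq => ?_⟩
    · exact decide_eq_of_modeSign_mul_pos (hsub hr)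
    · rcases hq.2.eq_or_lt with rfl | h
      · exact h0
      · exact le_of_lt (hsub ⟨hr.1.trans_le hq.1, h⟩)
  -- Either the mode is constant near `s`, or the line crosses from mode `!i` to mode `i`, and the
  -- jump condition then fixes the sign of the jump as seen by `ψ`.
  have hcase : ∀ s : ℝ, (∃ i, decide (0 < H (x + s • w)) = i ∧
        ∀ᶠ r in 𝓝 s, 0 < modeSign i * H (x + r • w)) ∨
      (H (x + s • w) = 0 ∧ ∃ i, modeSign i *
          ψ (f true (x + s • w, y + s • v) - f false (x + s • w, y + s • v)) ≤ 0 ∧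
        (∀ᶠ r in 𝓝[>] s, 0 < modeSign i * H (x + r • w)) ∧
        ∀ᶠ r in 𝓝[<] s, 0 < modeSign (!i) * H (x + r • w)) := by
    intro s
    have hd := hS.hasDerivAt_switching x w s
    rcases lt_trichotomy (H (x + s • w)) 0 with hlt | heq | hgt
    · left
      refine ⟨false, by simpa using hlt.le, ?_⟩
      filter_upwards [hd.continuousAt.eventually (gt_mem_nhds hlt)] with r hr
      simpa [modeSign] using hr
    · right
      refine ⟨heq, ?_⟩
      have hj := hS.jump (x + s • w) (y + s • v) w ψ heq hψ
      rcases lt_or_gt_of_ne (htr s heq) with hneg | hpos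
      · have he := hd.neg.eventually_sign_of_pos (by simp [heq]) (neg_pos.2 hneg)
        refine ⟨false, ?_, ?_, ?_⟩
        · have := nonneg_of_mul_nonpos_right hj hneg
          simpa [modeSign] using this
        · filter_upwards [he.1] with r hr
          simpa [modeSign] using hr
        · filter_upwards [he.2] with r hr
          simpa [modeSign] using hr
      · have he := hd.eventually_sign_of_pos heq hpos
        refine ⟨true, ?_, ?_, ?_⟩
        · have := nonpos_of_mul_nonpos_right hj hpos
          simpa [modeSign] using this
        · filter_upwards [he.1] with r hr
          simpa [modeSign] using hr
        · filter_upwards [he.2] with r hr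
          simpa [modeSign] using hr
    · left
      refine ⟨true, by simpa using hgt, ?_⟩
      filter_upwards [hd.continuousAt.eventually (lt_mem_nhds hgt)] with r hr
      simpa [modeSign] using hr
  refine antitone_of_eventually_nhdsWithin (fun s => ?_) fun s => ?_
  · rcases hcase s with ⟨i, hi, hev⟩ | ⟨h0, i, hi, -, hl⟩
    · filter_upwards [hleft i s hev.self_of_nhds.le (hev.filter_mono nhdsWithin_le_nhds)]
        with r hr
      rw [hi, hr.1]
      linarith [hr.2]
    · filter_upwards [hleft (!i) s (by simp [h0]) hl] with r hr
      rw [hr.1]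
      -- On the surface `decide` selects mode `false`; the sign of the jump covers the side whose
      -- mode is `true`.
      have hfalse : decide (0 < H (x + s • w)) = false := by simp [h0]
      rw [hfalse]
      cases i <;> simp [modeSign] at hi hr ⊢ <;> linarith [hr.2]
  · rcases hcase s with ⟨i, hi, hev⟩ | ⟨h0, i, hi, hr', -⟩
    · filter_upwards [hright i s hev.self_of_nhds.le (hev.filter_mono nhdsWithin_le_nhds)]
        with r hr
      rw [hi, hr.1]
      linarith [hr.2]
    · filter_upwards [hright i s (by simp [h0]) hr'] with r hr
      rw [hr.1]
      have hfalse : decide (0 < H (x + s • w)) = false := by simp [h0]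
      rw [hfalse]
      cases i <;> simp [modeSign] at hi hr ⊢ <;> linarith [hr.2]

/-- The small perturbations `(u, b)` of the segment from `y` to `y + w` for which the segment from
`y + u` to `y + u + b w` starts in the open region of mode `j` and ends in that of mode `i`. -/
def perturbations (H : E → ℝ) (w y : E) (i j : Bool) : Set (E × ℝ) :=
  {q | 0 < modeSign i * H (y + q.1 + q.2 • w) ∧ 0 < modeSign j * H (y + q.1) ∧ 0 < q.2}

/-- The perturbed segments with prescribed strict endpoint modes form an open set, in which the
transversal ones are dense. The estimate holds for these by monotonicity and is a closed condition
on the perturbation. -/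
theorem apply_sub_le_of_mem_closure [FiniteDimensional ℝ E] (hS : IsDissipativeSwitched H f p k)
    {ψ : E →L[ℝ] ℝ} {w : E} (hψ : IsNorming ψ w) (y : E) (y₀ v : F) {i j : Bool}
    (hcl : ((0 : E), (1 : ℝ)) ∈ closure (perturbations H w y i j)) :
    ψ (f i (y + w, y₀ + v) - f j (y, y₀)) ≤ -p * ‖w‖ + k * ‖v‖ := by
  have hH := hS.switching.1.continuous
  have hf := fun i => (hS.smooth i).continuous
  have hopen : IsOpen (perturbations H w y i j) := by
    have h1 : Continuous fun q : E × ℝ => modeSign i * H (y + q.1 + q.2 • w) := by fun_prop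
    have h2 : Continuous fun q : E × ℝ => modeSign j * H (y + q.1) := by fun_prop
    exact (isOpen_lt continuous_const h1).inter
      ((isOpen_lt continuous_const h2).inter (isOpen_lt continuous_const continuous_snd))
  have hdense := (dense_transversal_translates hS.switching y w).prod (dense_univ (X := ℝ))
  have hmem := closure_minimal (hdense.open_subset_closure_inter hopen) isClosed_closure hcl
  let C : Set (E × ℝ) := {q | ψ (f i (y + q.1 + q.2 • w, y₀ + q.2 • v) - f j (y + q.1, y₀)) ≤
    (-p * ‖w‖ + k * ‖v‖) * q.2}
  have hC : IsClosed C := isClosed_le (by fun_prop) (by fun_prop)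
  have hsub : perturbations H w y i j ∩
      {u | ∀ s : ℝ, H (y + u + s • w) = 0 → fderiv ℝ H (y + u + s • w) w ≠ 0} ×ˢ univ ⊆ C := by
    rintro ⟨u, b⟩ ⟨⟨h1, h2, h3⟩, htr, -⟩
    have hanti := hS.antitone_of_transversal hψ (y + u) y₀ v htr h3.le
    simp only [zero_smul, add_zero, mul_zero, sub_zero] at hanti h1 h2 h3
    rw [decide_eq_of_modeSign_mul_pos h1, decide_eq_of_modeSign_mul_pos h2] at hanti
    change ψ (f i (y + u + b • w, y₀ + b • v) - f j (y + u, y₀)) ≤ (-p * ‖w‖ + k * ‖v‖) * b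
    rw [map_sub]
    linarith
  have hfin := closure_minimal hsub hC hmem
  change ψ (f i (y + 0 + (1 : ℝ) • w, y₀ + (1 : ℝ) • v) - f j (y + 0, y₀)) ≤
    (-p * ‖w‖ + k * ‖v‖) * 1 at hfin
  simpa using hfin

theorem eventually_modeSign_mul_pos (hS : IsDissipativeSwitched H f p k) {i : Bool} {x e : E}
    (h0 : H x = 0 → 0 < modeSign i * fderiv ℝ H x e) (h1 : H x ≠ 0 → 0 < modeSign i * H x) :
    ∀ᶠ r in 𝓝[>] (0 : ℝ), 0 < modeSign i * H (x + r • e) := by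
  have hd := (hS.hasDerivAt_switching x e 0).const_mul (modeSign i)
  simp only [zero_smul, add_zero] at hd
  by_cases hx : H x = 0
  · exact (hd.eventually_sign_of_pos (by simp [hx]) (h0 hx)).1
  · refine (hd.continuousAt.eventually (lt_mem_nhds ?_)).filter_mono nhdsWithin_le_nhds
    simpa using h1 hx

/-- Along the ray `(r • u, 1 + r * b)`, `r → 0⁺`, an endpoint off the surface keeps its sign, while
one on it leaves with velocity `u` (at `y`) or `u + b • w` (at `y + w`). -/
theorem mem_closure_perturbations (hS : IsDissipativeSwitched H f p k) {i j : Bool} {y w u : E}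
    {b : ℝ} (hx0 : H (y + w) = 0 → 0 < modeSign i * fderiv ℝ H (y + w) (u + b • w))
    (hx1 : H (y + w) ≠ 0 → 0 < modeSign i * H (y + w))
    (hy0 : H y = 0 → 0 < modeSign j * fderiv ℝ H y u) (hy1 : H y ≠ 0 → 0 < modeSign j * H y) :
    ((0 : E), (1 : ℝ)) ∈ closure (perturbations H w y i j) := by
  have ht : Tendsto (fun r : ℝ => (r • u, 1 + r * b)) (𝓝[>] 0) (𝓝 ((0 : E), (1 : ℝ))) := by
    have hc : Continuous (fun r : ℝ => (r • u, 1 + r * b)) := by fun_prop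
    have := hc.tendsto 0
    simp only [zero_smul, zero_mul, add_zero] at this
    exact this.mono_left nhdsWithin_le_nhds
  refine mem_closure_of_tendsto ht ?_
  have hpos : ∀ᶠ r in 𝓝[>] (0 : ℝ), 0 < 1 + r * b := by
    have hc : Continuous (fun r : ℝ => 1 + r * b) := by fun_prop
    exact (hc.continuousAt.eventually (lt_mem_nhds (by simp))).filter_mono nhdsWithin_le_nhds
  filter_upwards [hpos, hS.eventually_modeSign_mul_pos hx0 hx1,
    hS.eventually_modeSign_mul_pos hy0 hy1] with r h1 h2 h3
  refine ⟨?_, h3, h1⟩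
  have : y + r • u + (1 + r * b) • w = y + w + r • (u + b • w) := by module
  simpa only [this] using h2

end IsDissipativeSwitched

end SwitchedField

/-! ### Endpoints on the surface and the Filippov regularization -/

section SwitchedField

variable {E F : Type*} [NormedAddCommGroup E] [NormedSpace ℝ E]
  [NormedAddCommGroup F] [NormedSpace ℝ F]

theorem modeSign_mul_self (i : Bool) : modeSign i * modeSign i = 1 := by
  cases i <;> simp [modeSign]

theorem modeSign_ne_zero (i : Bool) : modeSign i ≠ 0 := by
  cases i <;> simp [modeSign]

theorem exists_modeSign_mul_pos {a : ℝ} (ha : a ≠ 0) : ∃ i, 0 < modeSign i * a := by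
  rcases lt_or_gt_of_ne ha with h | h
  · exact ⟨false, by simpa [modeSign] using h⟩
  · exact ⟨true, by simpa [modeSign] using h⟩

/-- Two nonzero functionals have a vector at which the first has a prescribed sign and the second
does not vanish. -/
theorem exists_modeSign_mul_pos_and_ne_zero {L M : E →L[ℝ] ℝ} (hL : L ≠ 0) (hM : M ≠ 0)
    (j : Bool) : ∃ u, 0 < modeSign j * L u ∧ M u ≠ 0 := by
  obtain ⟨a, ha⟩ := exists_apply_eq_one_of_ne_zero hL
  obtain ⟨b, hb⟩ := exists_apply_eq_one_of_ne_zero hM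
  have hja : modeSign j * L (modeSign j • a) = 1 := by
    rw [map_smul, ha, smul_eq_mul, mul_one, modeSign_mul_self]
  by_cases h0 : M (modeSign j • a) = 0
  · have hc : Continuous fun r : ℝ => modeSign j * L (modeSign j • a + r • b) := by fun_prop
    have hev : ∀ᶠ r in 𝓝[>] (0 : ℝ), 0 < modeSign j * L (modeSign j • a + r • b) := by
      refine (hc.continuousAt.eventually (lt_mem_nhds ?_)).filter_mono nhdsWithin_le_nhds
      simp only [zero_smul, add_zero, hja, zero_lt_one]
    obtain ⟨r, hr, hr0⟩ := (hev.and self_mem_nhdsWithin).exists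
    have hr0 : 0 < r := hr0
    refine ⟨_, hr, ?_⟩
    rw [map_add, h0, map_smul, hb]
    simpa using hr0.ne'
  · exact ⟨_, by rw [hja]; exact zero_lt_one, h0⟩

theorem apply_le_of_mem_filippovSet {h : ℝ} {v₁ v₂ v : E} (hv : v ∈ filippovSet h v₁ v₂)
    (L : E →L[ℝ] ℝ) {c : ℝ} (h₁ : 0 ≤ h → L v₁ ≤ c) (h₂ : h ≤ 0 → L v₂ ≤ c) : L v ≤ c := by
  unfold filippovSet at hv
  split_ifs at hv with hp hn
  · rw [mem_singleton_iff.1 hv]; exact h₁ hp.le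
  · rw [mem_singleton_iff.1 hv]; exact h₂ hn.le
  · have h0 : h = 0 := le_antisymm (not_lt.1 hp) (not_lt.1 hn)
    obtain ⟨a, b, ha, hb, hab, rfl⟩ := hv
    rw [map_add, map_smul, map_smul, smul_eq_mul, smul_eq_mul]
    have h3 := mul_le_mul_of_nonneg_left (h₁ h0.ge) ha
    have h4 := mul_le_mul_of_nonneg_left (h₂ h0.le) hb
    have h5 : a * c + b * c = c := by rw [← add_mul, hab, one_mul]
    linarith

namespace IsDissipativeSwitched

variable {H : E → ℝ} {f : Bool → E × F → E} {p k : ℝ}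

/-- In a direction tangent to the switching surface, some norming functional does not see the
jump of the vector field. -/
theorem exists_isNorming_jump_eq_zero (hS : IsDissipativeSwitched H f p k) {x w : E} (y : F)
    (hx : H x = 0) (hw : fderiv ℝ H x w = 0) :
    ∃ ψ : E →L[ℝ] ℝ, IsNorming ψ w ∧ ψ (f true (x, y) - f false (x, y)) = 0 := by
  refine exists_isNorming_apply_eq_zero fun s => ?_
  set d := f true (x, y) - f false (x, y)
  obtain ⟨n, hn⟩ := exists_apply_eq_one_of_ne_zero (hS.switching.2 x hx)
  -- Tilting `w` by `r • n` off the tangent space makes the jump condition informative: `r * ψ d ≤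
  -- 0`, hence `s * ψ d ≥ 0` when `r` and `s` have opposite signs. Then `r → 0` gives Birkhoff
  -- orthogonality.
  have key : ∀ r : ℝ, r * s < 0 → ‖w + r • n‖ ≤ ‖w + r • n + s • d‖ := by
    intro r hr
    obtain ⟨ψ, hψ⟩ := exists_isNorming (w + r • n)
    have hj := hS.jump x y (w + r • n) ψ hx hψ
    rw [map_add, hw, map_smul, hn, smul_eq_mul, mul_one, zero_add] at hj
    have h1 := hψ.apply_le (w + r • n + s • d)
    rw [map_add, hψ.2, map_smul, smul_eq_mul] at h1
    have h2 : 0 ≤ s * ψ d := by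
      rcases lt_trichotomy r 0 with h | h | h
      · have hs : 0 < s := by nlinarith
        have : 0 ≤ ψ d := nonneg_of_mul_nonpos_right hj h
        positivity
      · simp [h] at hr
      · have hs : s < 0 := by nlinarith
        exact mul_nonneg_of_nonpos_of_nonpos hs.le (nonpos_of_mul_nonpos_right hj h)
    linarith
  rcases eq_or_ne s 0 with rfl | hs
  · simp
  have ht : Tendsto (fun r : ℝ => -(r * s)) (𝓝[>] 0) (𝓝 0) := by
    have hc : Continuous fun r : ℝ => -(r * s) := by fun_prop
    have := hc.tendsto 0
    simp only [zero_mul, neg_zero] at this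
    exact this.mono_left nhdsWithin_le_nhds
  have h1 : Continuous fun r : ℝ => ‖w + r • n‖ := by fun_prop
  have h2 : Continuous fun r : ℝ => ‖w + r • n + s • d‖ := by fun_prop
  have h3 := le_of_tendsto_of_tendsto ((h1.tendsto 0).comp ht) ((h2.tendsto 0).comp ht) (by
    filter_upwards [self_mem_nhdsWithin] with r hr
    have hr : 0 < r := hr
    refine key _ ?_
    have : 0 < s * s := mul_self_pos.2 hs
    nlinarith)
  simpa using h3

/-- A single `ψ` must serve all admissible mode pairs, since convex combinations are taken
afterwards. If `w` is not tangent at `y + w`, stretching the segment moves that endpoint into any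
required mode independently of `y`. If it is tangent, stretching has no first-order effect, and a
`ψ` blind to the jump makes the mode there irrelevant. -/
theorem exists_isNorming_forall_modes [FiniteDimensional ℝ E] (hS : IsDissipativeSwitched H f p k)
    (y w : E) (y₀ v : F) :
    ∃ ψ : E →L[ℝ] ℝ, IsNorming ψ w ∧ ∀ i j, 0 ≤ modeSign i * H (y + w) → 0 ≤ modeSign j * H y →
      ψ (f i (y + w, y₀ + v) - f j (y, y₀)) ≤ -p * ‖w‖ + k * ‖v‖ := by
  by_cases hx : H (y + w) = 0 ∧ fderiv ℝ H (y + w) w = 0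
  · obtain ⟨ψ, hψ, hd⟩ := hS.exists_isNorming_jump_eq_zero (y₀ + v) hx.1 hx.2
    refine ⟨ψ, hψ, fun i j _ hj => ?_⟩
    have hgx := hS.switching.2 _ hx.1
    -- The shift must send `y` into mode `j` and push `y + w` off the surface, into whichever mode
    -- `i'` results.
    have hu : ∃ u, fderiv ℝ H (y + w) u ≠ 0 ∧ (H y = 0 → 0 < modeSign j * fderiv ℝ H y u) := by
      by_cases hy : H y = 0
      · obtain ⟨u, h1, h2⟩ := exists_modeSign_mul_pos_and_ne_zero (hS.switching.2 _ hy) hgx j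
        exact ⟨u, h2, fun _ => h1⟩
      · obtain ⟨u, hu⟩ := exists_apply_eq_one_of_ne_zero hgx
        exact ⟨u, by simp [hu], fun h => absurd h hy⟩
    obtain ⟨u, hu1, hu2⟩ := hu
    obtain ⟨i', hi'⟩ := exists_modeSign_mul_pos hu1
    have hcl := hS.mem_closure_perturbations (i := i') (j := j) (y := y) (w := w) (u := u) (b := 0)
      (fun _ => by simpa using hi') (fun h => absurd hx.1 h) hu2
      fun h => hj.lt_of_ne' (mul_ne_zero (modeSign_ne_zero j) h)
    have hle := hS.apply_sub_le_of_mem_closure hψ y y₀ v hcl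
    rw [map_sub, sub_eq_zero] at hd
    have heq : ψ (f i (y + w, y₀ + v)) = ψ (f i' (y + w, y₀ + v)) := by
      cases i <;> cases i' <;> simp [hd]
    rw [map_sub] at hle ⊢
    rwa [heq]
  · obtain ⟨ψ, hψ⟩ := exists_isNorming w
    refine ⟨ψ, hψ, fun i j hi hj => ?_⟩
    have hu : ∃ u, H y = 0 → 0 < modeSign j * fderiv ℝ H y u := by
      by_cases hy : H y = 0
      · obtain ⟨u, h1, -⟩ := exists_modeSign_mul_pos_and_ne_zero (hS.switching.2 _ hy)
          (hS.switching.2 _ hy) j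
        exact ⟨u, fun _ => h1⟩
      · exact ⟨0, fun h => absurd h hy⟩
    obtain ⟨u, hu⟩ := hu
    -- The stretch `b` solves `fderiv ℝ H (y + w) (u + b • w) = modeSign i` when `y + w` is on the
    -- surface.
    refine hS.apply_sub_le_of_mem_closure hψ y y₀ v (hS.mem_closure_perturbations (u := u)
      (b := (modeSign i - fderiv ℝ H (y + w) u) / fderiv ℝ H (y + w) w) (fun h => ?_)
      (fun h => hi.lt_of_ne' (mul_ne_zero (modeSign_ne_zero i) h)) hu
      fun h => hj.lt_of_ne' (mul_ne_zero (modeSign_ne_zero j) h))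
    have hw : fderiv ℝ H (y + w) w ≠ 0 := fun h' => hx ⟨h, h'⟩
    rw [map_add, map_smul, smul_eq_mul, div_mul_cancel₀ _ hw, add_sub_cancel, modeSign_mul_self]
    exact zero_lt_one

/-- The Filippov regularization of a dissipative switched vector field is dissipative. -/
theorem exists_isNorming_filippov [FiniteDimensional ℝ E] (hS : IsDissipativeSwitched H f p k)
    (x y : E) (x₀ y₀ : F) :
    ∃ ψ : E →L[ℝ] ℝ, IsNorming ψ (x - y) ∧
      ∀ a ∈ filippovSet (H x) (f true (x, x₀)) (f false (x, x₀)),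
      ∀ b ∈ filippovSet (H y) (f true (y, y₀)) (f false (y, y₀)),
        ψ (a - b) ≤ -p * ‖x - y‖ + k * ‖x₀ - y₀‖ := by
  obtain ⟨ψ, hψ, hle⟩ := hS.exists_isNorming_forall_modes y (x - y) y₀ (x₀ - y₀)
  simp only [add_sub_cancel, map_sub] at hle
  refine ⟨ψ, hψ, fun a ha b hb => ?_⟩
  set c := -p * ‖x - y‖ + k * ‖x₀ - y₀‖
  -- Convexity is used twice: in `b` with the mode at `x` fixed, then in `a`.
  have hb' : ∀ i, 0 ≤ modeSign i * H x → ψ (f i (x, x₀)) - c ≤ ψ b := by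
    intro i hi
    have := apply_le_of_mem_filippovSet hb (-ψ) (c := -(ψ (f i (x, x₀)) - c))
      (fun h => by
        have := hle i true hi (by simpa [modeSign] using h)
        simp only [neg_apply]; linarith)
      (fun h => by
        have := hle i false hi (by simpa [modeSign] using h)
        simp only [neg_apply]; linarith)
    simp only [neg_apply] at this
    linarith
  have := apply_le_of_mem_filippovSet ha ψ (c := ψ b + c)
    (fun h => by linarith [hb' true (by simpa [modeSign] using h)])
    (fun h => by linarith [hb' false (by simpa [modeSign] using h)])
  rw [map_sub]
  linarith

end IsDissipativeSwitched

end SwitchedField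

/-! ### Differentiating norms, Grönwall, and the small-gain weight -/

section Comparison

variable {E : Type*} [NormedAddCommGroup E] [NormedSpace ℝ E]

theorem AbsolutelyContinuousOnInterval.of_dist_le {X Y : Type*} [PseudoMetricSpace X]
    [PseudoMetricSpace Y] {f : ℝ → X} {g : ℝ → Y} {a b : ℝ}
    (hf : AbsolutelyContinuousOnInterval f a b) (h : ∀ s t, dist (g s) (g t) ≤ dist (f s) (f t)) :
    AbsolutelyContinuousOnInterval g a b :=
  squeeze_zero (fun _ => Finset.sum_nonneg fun _ _ => dist_nonneg)
    (fun _ => Finset.sum_le_sum fun _ _ => h _ _) hf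

theorem AbsolutelyContinuousOnInterval.norm {E : Type*} [NormedAddCommGroup E] {f : ℝ → E} {a b : ℝ}
    (hf : AbsolutelyContinuousOnInterval f a b) :
    AbsolutelyContinuousOnInterval (fun t => ‖f t‖) a b :=
  hf.of_dist_le fun s t => (dist_norm_norm_le (f s) (f t)).trans_eq (dist_eq_norm _ _).symm

/-- The derivative of the norm along a curve is given by any norming functional. -/
theorem IsNorming.deriv_norm_eq {w : ℝ → E} {w' : E} {t : ℝ} {ψ : E →L[ℝ] ℝ}
    (hψ : IsNorming ψ (w t)) (hw : HasDerivAt w w' t)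
    (hn : DifferentiableAt ℝ (fun s => ‖w s‖) t) : deriv (fun s => ‖w s‖) t = ψ w' := by
  have hd : HasDerivAt (fun s => ‖w s‖ - ψ (w s)) (deriv (fun s => ‖w s‖) t - ψ w') t :=
    hn.hasDerivAt.sub (ψ.hasFDerivAt.comp_hasDerivAt t hw)
  -- The norm dominates `ψ`, with equality at time `t`, so the difference of the two has zero
  -- derivative there.
  have hmin : IsLocalMin (fun s => ‖w s‖ - ψ (w s)) t := by
    refine Eventually.of_forall fun s => ?_
    simp only [hψ.2, sub_self]
    exact sub_nonneg.2 (hψ.apply_le _)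
  exact sub_eq_zero.1 (hmin.hasDerivAt_eq_zero hd)

/-- Grönwall's inequality for absolutely continuous functions. -/
theorem AbsolutelyContinuousOnInterval.le_exp_mul_of_ae_deriv_le {V : ℝ → ℝ} {a b c : ℝ}
    (hV : AbsolutelyContinuousOnInterval V a b)
    (hd : ∀ᵐ t, t ∈ Icc a b → deriv V t ≤ -c * V t) {t : ℝ} (ht : t ∈ Icc a b) :
    V t ≤ Real.exp (-c * (t - a)) * V a := by
  have hsub : Icc a t ⊆ Icc a b := Icc_subset_Icc_right ht.2
  have hVt : AbsolutelyContinuousOnInterval V a t :=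
    hV.mono (by rwa [uIcc_of_le ht.1, uIcc_of_le (ht.1.trans ht.2)])
  have hexp : ContDiff ℝ 1 fun s : ℝ => Real.exp (c * s) := by fun_prop
  have hG : AbsolutelyContinuousOnInterval (fun s => Real.exp (c * s) * V s) a t :=
    (hexp.contDiffOn.absolutelyContinuousOnInterval).mul hVt
  have hle : ∫ s in a..t, deriv (fun s => Real.exp (c * s) * V s) s ≤ 0 := by
    rw [intervalIntegral.integral_of_le ht.1]
    refine setIntegral_nonpos_ae measurableSet_Ioc ?_
    filter_upwards [hd, hVt.ae_differentiableAt] with s h1 h2 hs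
    have hs' : s ∈ Icc a t := Ioc_subset_Icc_self hs
    have h3 := (h2 (by rwa [uIcc_of_le ht.1])).hasDerivAt
    have h4 : HasDerivAt (fun s : ℝ => Real.exp (c * s)) (Real.exp (c * s) * c) s := by
      simpa using ((hasDerivAt_id s).const_mul c).exp
    have h6 : deriv (fun s => Real.exp (c * s) * V s) s =
        Real.exp (c * s) * c * V s + Real.exp (c * s) * deriv V s := (h4.mul h3).deriv
    rw [h6]
    have h5 := mul_le_mul_of_nonneg_left (h1 (hsub hs')) (Real.exp_pos (c * s)).le
    linarith
  rw [hG.integral_deriv_eq_sub] at hle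
  have h1 : Real.exp (c * t) * V t ≤ Real.exp (c * a) * V a := by linarith
  have h2 : Real.exp (-c * (t - a)) * V a = Real.exp (-(c * t)) * (Real.exp (c * a) * V a) := by
    rw [← mul_assoc, ← Real.exp_add]; ring_nf
  have h3 : V t = Real.exp (-(c * t)) * (Real.exp (c * t) * V t) := by
    rw [← mul_assoc, ← Real.exp_add]; simp
  rw [h2, h3]
  exact mul_le_mul_of_nonneg_left h1 (Real.exp_pos _).le

/-- Under the small-gain condition, a positive combination of two coupled dissipation inequalities
is dissipative. -/
theorem exists_smallGain_weight {p q k m : ℝ} (hq : 0 < q) (hk : 0 < k) (hm : 0 < m)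
    (hgain : k * m < p * q) :
    ∃ β > 0, ∃ c > 0, m * β ≤ p - c ∧ k ≤ (q - c) * β := by
  have h1 : k / q < p / m := by
    rw [div_lt_div_iff₀ hq hm]; linarith
  -- The gap between `k / q` and `p / m` is the small-gain condition; it leaves `p - m * β` and `q -
  -- k / β` positive, and `c` is their minimum.
  obtain ⟨β, hβ1, hβ2⟩ := exists_between h1
  have hβ : 0 < β := (div_pos hk hq).trans hβ1
  rw [div_lt_iff₀ hq] at hβ1
  rw [lt_div_iff₀ hm] at hβ2
  refine ⟨β, hβ, min (p - m * β) (q - k / β), lt_min (by linarith) ?_, ?_, ?_⟩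
  · rw [sub_pos, div_lt_iff₀ hβ]; linarith
  · linarith [min_le_left (p - m * β) (q - k / β), mul_comm m β]
  · have h2 : k / β ≤ q - min (p - m * β) (q - k / β) := by
      linarith [min_le_right (p - m * β) (q - k / β)]
    rwa [div_le_iff₀ hβ] at h2

end Comparison

/-! ### From matrix measures to dissipativity -/

section Interconnection

variable {E F G : Type*} [NormedAddCommGroup E] [NormedSpace ℝ E]
  [NormedAddCommGroup F] [NormedSpace ℝ F] [NormedAddCommGroup G] [NormedSpace ℝ G]

theorem fderiv_prod_apply_eq_add {g : E × F → G} (hg : ContDiff ℝ 1 g) (x w : E) (y v : F) :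
    fderiv ℝ g (x, y) (w, v) =
      fderiv ℝ (fun z => g (z, y)) x w + fderiv ℝ (fun z => g (x, z)) y v := by
  have hd := (hg.differentiable (by simp) (x, y)).hasFDerivAt
  have h1 : HasFDerivAt (fun z => g (z, y)) _ x := hd.comp x (hasFDerivAt_prodMk_left x y)
  have h2 : HasFDerivAt (fun z => g (x, z)) _ y := hd.comp y (hasFDerivAt_prodMk_right x y)
  rw [h1.fderiv, h2.fderiv]
  simp [← map_add]

theorem IsNorming.apply_fderiv_prod_le {g : E × F → E} (hg : ContDiff ℝ 1 g) {x w : E} {y v : F}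
    {ψ : E →L[ℝ] ℝ} (hψ : IsNorming ψ w) {p k p' k' : ℝ}
    (hμ : matrixMeasure (fderiv ℝ (fun z => g (z, y)) x) ≤ -p')
    (hk : ‖fderiv ℝ (fun z => g (x, z)) y‖ ≤ k') (hp : p ≤ p') (hkk : k' ≤ k) :
    ψ (fderiv ℝ g (x, y) (w, v)) ≤ -p * ‖w‖ + k * ‖v‖ := by
  rw [fderiv_prod_apply_eq_add hg, map_add]
  refine add_le_add ?_ ?_
  · exact hψ.apply_le_of_matrixMeasure_le (hμ.trans (neg_le_neg hp))
  · exact (hψ.apply_le _).trans (ContinuousLinearMap.le_of_opNorm_le _ (hk.trans hkk) v)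

/-- Pairing with a norming functional turns each Jacobian bound into a directional one; for the
rank-one operator `jumpGrad` the pairing is exactly the product in the jump condition. -/
theorem isDissipativeSwitched_of_matrixMeasure_le {H : E → ℝ} (hH : IsSwitchingFunction H)
    {g₁ g₂ : E × F → E} (hg₁ : ContDiff ℝ 1 g₁) (hg₂ : ContDiff ℝ 1 g₂) {p₁ p₂ k₁ k₂ : ℝ}
    (hμ₁ : ∀ x y, 0 ≤ H x → matrixMeasure (fderiv ℝ (fun z => g₁ (z, y)) x) ≤ -p₁)
    (hμ₂ : ∀ x y, H x ≤ 0 → matrixMeasure (fderiv ℝ (fun z => g₂ (z, y)) x) ≤ -p₂)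
    (hχ : ∀ x y, H x = 0 → matrixMeasure (jumpGrad H x (g₁ (x, y) - g₂ (x, y))) = 0)
    (hk₁ : ∀ x y, 0 ≤ H x → ‖fderiv ℝ (fun z => g₁ (x, z)) y‖ ≤ k₁)
    (hk₂ : ∀ x y, H x ≤ 0 → ‖fderiv ℝ (fun z => g₂ (x, z)) y‖ ≤ k₂) :
    IsDissipativeSwitched H (fun i => bif i then g₁ else g₂) (min p₁ p₂) (max k₁ k₂) where
  switching := hH
  smooth := by rintro (_ | _) <;> assumption
  rate := by
    rintro (_ | _) x y w v ψ hi hψ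
    · have hx : H x ≤ 0 := by simpa [modeSign] using hi
      exact hψ.apply_fderiv_prod_le hg₂ (hμ₂ x y hx) (hk₂ x y hx) (min_le_right _ _)
        (le_max_right _ _)
    · have hx : 0 ≤ H x := by simpa [modeSign] using hi
      exact hψ.apply_fderiv_prod_le hg₁ (hμ₁ x y hx) (hk₁ x y hx) (min_le_left _ _)
        (le_max_left _ _)
  jump := by
    intro x y w ψ hx hψ
    have := hψ.apply_le_of_matrixMeasure_le (hχ x y hx).le
    rw [zero_mul, jumpGrad, ContinuousLinearMap.smulRight_apply, map_smul, smul_eq_mul] at this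
    exact this

end Interconnection

/-! ### The small-gain theorem -/

theorem theorem1
    {E₁ E₂ : Type*}
    [NormedAddCommGroup E₁] [NormedSpace ℝ E₁] [FiniteDimensional ℝ E₁]
    [NormedAddCommGroup E₂] [NormedSpace ℝ E₂] [FiniteDimensional ℝ E₂]
    (H₁ : E₁ → ℝ) (H₂ : E₂ → ℝ)
    (f₁₁ f₁₂ : E₁ → E₂ → ℝ → E₁) (f₂₁ f₂₂ : E₁ → E₂ → ℝ → E₂)
    (hH₁ : IsSwitchingFunction H₁) (hH₂ : IsSwitchingFunction H₂)
    (hf₁₁ : IsSmoothMode f₁₁) (hf₁₂ : IsSmoothMode f₁₂)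
    (hf₂₁ : IsSmoothMode f₂₁) (hf₂₂ : IsSmoothMode f₂₂)
    (p₁ p₂ q₁ q₂ k₁ k₂ m₁ m₂ : ℝ)
    (hp₁ : 0 < p₁) (hp₂ : 0 < p₂) (hq₁ : 0 < q₁) (hq₂ : 0 < q₂)
    (hk₁ : 0 < k₁) (hk₂ : 0 < k₂) (hm₁ : 0 < m₁) (hm₂ : 0 < m₂)
    -- each mode is contracting in its own state, on its own closed region
    (hμ₁₁ : ∀ ξ₁ ξ₂ t, 0 ≤ t → 0 ≤ H₁ ξ₁ → matrixMeasure (jac₁ f₁₁ ξ₁ ξ₂ t) ≤ -p₁)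
    (hμ₁₂ : ∀ ξ₁ ξ₂ t, 0 ≤ t → H₁ ξ₁ ≤ 0 → matrixMeasure (jac₁ f₁₂ ξ₁ ξ₂ t) ≤ -p₂)
    (hμ₂₁ : ∀ ξ₁ ξ₂ t, 0 ≤ t → 0 ≤ H₂ ξ₂ → matrixMeasure (jac₂ f₂₁ ξ₁ ξ₂ t) ≤ -q₁)
    (hμ₂₂ : ∀ ξ₁ ξ₂ t, 0 ≤ t → H₂ ξ₂ ≤ 0 → matrixMeasure (jac₂ f₂₂ ξ₁ ξ₂ t) ≤ -q₂)
    -- the switching terms have zero matrix measure on the switching surfaces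
    (hχ₁ : ∀ ξ₁ ξ₂ t, 0 ≤ t → H₁ ξ₁ = 0 →
      matrixMeasure (jumpGrad H₁ ξ₁ (f₁₁ ξ₁ ξ₂ t - f₁₂ ξ₁ ξ₂ t)) = 0)
    (hχ₂ : ∀ ξ₁ ξ₂ t, 0 ≤ t → H₂ ξ₂ = 0 →
      matrixMeasure (jumpGrad H₂ ξ₂ (f₂₁ ξ₁ ξ₂ t - f₂₂ ξ₁ ξ₂ t)) = 0)
    -- the interconnection Jacobians are bounded
    (hk₁₁ : ∀ ξ₁ ξ₂ t, 0 ≤ t → 0 ≤ H₁ ξ₁ → ‖jac₂ f₁₁ ξ₁ ξ₂ t‖ ≤ k₁)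
    (hk₁₂ : ∀ ξ₁ ξ₂ t, 0 ≤ t → H₁ ξ₁ ≤ 0 → ‖jac₂ f₁₂ ξ₁ ξ₂ t‖ ≤ k₂)
    (hm₂₁ : ∀ ξ₁ ξ₂ t, 0 ≤ t → 0 ≤ H₂ ξ₂ → ‖jac₁ f₂₁ ξ₁ ξ₂ t‖ ≤ m₁)
    (hm₂₂ : ∀ ξ₁ ξ₂ t, 0 ≤ t → H₂ ξ₂ ≤ 0 → ‖jac₁ f₂₂ ξ₁ ξ₂ t‖ ≤ m₂)
    -- small-gain condition
    (hgain : max k₁ k₂ * max m₁ m₂ / (min p₁ p₂ * min q₁ q₂) < 1) :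
    ExpIncrementallyStable (feedbackInclusion H₁ H₂ f₁₁ f₁₂ f₂₁ f₂₂) := by

  have hk : 0 < max k₁ k₂ := lt_max_of_lt_left hk₁
  have hm : 0 < max m₁ m₂ := lt_max_of_lt_left hm₁
  have hp : 0 < min p₁ p₂ := lt_min hp₁ hp₂
  have hq : 0 < min q₁ q₂ := lt_min hq₁ hq₂
  rw [div_lt_one (mul_pos hp hq)] at hgain
  obtain ⟨β, hβ, c, hc, hc₁, hc₂⟩ := exists_smallGain_weight hq hk hm hgain
  have hI : ∀ t, 0 ≤ t → IsDissipativeSwitched H₁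
      (fun i => bif i then (fun ξ : E₁ × E₂ => f₁₁ ξ.1 ξ.2 t) else fun ξ => f₁₂ ξ.1 ξ.2 t)
      (min p₁ p₂) (max k₁ k₂) := fun t ht =>
    isDissipativeSwitched_of_matrixMeasure_le hH₁ (hf₁₁ t ht) (hf₁₂ t ht)
      (fun x y => hμ₁₁ x y t ht) (fun x y => hμ₁₂ x y t ht) (fun x y => hχ₁ x y t ht)
      (fun x y => hk₁₁ x y t ht) (fun x y => hk₁₂ x y t ht)
  -- The factors are swapped, so that system II's own state comes first and system I's state is the
  -- input.
  have hII : ∀ t, 0 ≤ t → IsDissipativeSwitched H₂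
      (fun i => bif i then (fun ξ : E₂ × E₁ => f₂₁ ξ.2 ξ.1 t) else fun ξ => f₂₂ ξ.2 ξ.1 t)
      (min q₁ q₂) (max m₁ m₂) := fun t ht =>
    isDissipativeSwitched_of_matrixMeasure_le hH₂
      ((hf₂₁ t ht).comp (contDiff_snd.prodMk contDiff_fst))
      ((hf₂₂ t ht).comp (contDiff_snd.prodMk contDiff_fst))
      (fun x y => hμ₂₁ y x t ht) (fun x y => hμ₂₂ y x t ht) (fun x y => hχ₂ y x t ht)
      (fun x y => hm₂₁ y x t ht) (fun x y => hm₂₂ y x t ht)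
  -- The overshoot comes from `min 1 β * ‖z‖ ≤ ‖z.1‖ + β * ‖z.2‖ ≤ (1 + β) * ‖z‖` in the max norm.
  refine ⟨(1 + β) / min 1 β, by positivity, c, hc, ?_⟩
  intro t₀ t₁ ht₀ ht₁ x y hx hy t ht
  have hw := hx.1.sub hy.1
  have hn₁ : AbsolutelyContinuousOnInterval (fun s => ‖(x s).1 - (y s).1‖) t₀ t₁ :=
    (hw.of_dist_le (g := fun s => (x s).1 - (y s).1) fun s r =>
      le_max_left (dist ((x s - y s).1) ((x r - y r).1)) _).norm
  have hn₂ : AbsolutelyContinuousOnInterval (fun s => ‖(x s).2 - (y s).2‖) t₀ t₁ :=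
    (hw.of_dist_le (g := fun s => (x s).2 - (y s).2) fun s r =>
      le_max_right _ (dist ((x s - y s).2) ((x r - y r).2))).norm
  let V : ℝ → ℝ := fun s => ‖(x s).1 - (y s).1‖ + β * ‖(x s).2 - (y s).2‖
  have hV : AbsolutelyContinuousOnInterval V t₀ t₁ := hn₁.add (hn₂.const_mul β)
  have hx' := (ae_restrict_iff' measurableSet_Icc).1 hx.2
  have hy' := (ae_restrict_iff' measurableSet_Icc).1 hy.2
  have hd : ∀ᵐ s, s ∈ Icc t₀ t₁ → deriv V s ≤ -c * V s := by
    filter_upwards [hx', hy', hn₁.ae_differentiableAt, hn₂.ae_differentiableAt]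
      with s hxs hys hs₁ hs₂ hs
    have hs0 : 0 ≤ s := ht₀.trans hs.1
    have hsu : s ∈ uIcc t₀ t₁ := by rwa [uIcc_of_le ht₁]
    obtain ⟨a, ha, hxa⟩ := hxs hs
    obtain ⟨b, hb, hyb⟩ := hys hs
    obtain ⟨ψ₁, hψ₁, hle₁⟩ :=
      (hI s hs0).exists_isNorming_filippov (x s).1 (y s).1 (x s).2 (y s).2
    obtain ⟨ψ₂, hψ₂, hle₂⟩ :=
      (hII s hs0).exists_isNorming_filippov (x s).2 (y s).2 (x s).1 (y s).1
    have h₁ := hle₁ a.1 ha.1 b.1 hb.1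
    have h₂ := hle₂ a.2 ha.2 b.2 hb.2
    have hd₁ : HasDerivAt (fun s => (x s).1 - (y s).1) (a.1 - b.1) s :=
      (ContinuousLinearMap.fst ℝ E₁ E₂).hasFDerivAt.comp_hasDerivAt s (hxa.sub hyb)
    have hd₂ : HasDerivAt (fun s => (x s).2 - (y s).2) (a.2 - b.2) s :=
      (ContinuousLinearMap.snd ℝ E₁ E₂).hasFDerivAt.comp_hasDerivAt s (hxa.sub hyb)
    -- The functionals may vary with `s` in any manner, since each only evaluates a derivative at
    -- that instant.
    rw [← IsNorming.deriv_norm_eq (w := fun s => (x s).1 - (y s).1) hψ₁ hd₁ (hs₁ hsu)] at h₁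
    rw [← IsNorming.deriv_norm_eq (w := fun s => (x s).2 - (y s).2) hψ₂ hd₂ (hs₂ hsu)] at h₂
    have hdV : deriv V s = deriv (fun s => ‖(x s).1 - (y s).1‖) s +
        β * deriv (fun s => ‖(x s).2 - (y s).2‖) s :=
      ((hs₁ hsu).hasDerivAt.add ((hs₂ hsu).hasDerivAt.const_mul β)).deriv
    rw [hdV]
    simp only [V]
    have e₁ := mul_le_mul_of_nonneg_left h₂ hβ.le
    have e₂ := mul_le_mul_of_nonneg_right hc₁ (norm_nonneg ((x s).1 - (y s).1))
    have e₃ := mul_le_mul_of_nonneg_right hc₂ (norm_nonneg ((x s).2 - (y s).2))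
    linarith
  have hdec := hV.le_exp_mul_of_ae_deriv_le hd ht
  have hmin : 0 < min 1 β := lt_min one_pos hβ
  have hlow : min 1 β * ‖x t - y t‖ ≤ V t := by
    have h1 := norm_nonneg ((x t).1 - (y t).1)
    have h2 := norm_nonneg ((x t).2 - (y t).2)
    have h3 := mul_le_mul_of_nonneg_right (min_le_left 1 β) h1
    have h4 := mul_le_mul_of_nonneg_right (min_le_right 1 β) h2
    rw [Prod.norm_def, Prod.fst_sub, Prod.snd_sub]
    rcases max_choice ‖(x t).1 - (y t).1‖ ‖(x t).2 - (y t).2‖ with h | h <;> rw [h] <;>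
      simp only [V] <;> nlinarith
  have hup : V t₀ ≤ (1 + β) * ‖x t₀ - y t₀‖ := by
    have h1 : ‖(x t₀).1 - (y t₀).1‖ ≤ ‖x t₀ - y t₀‖ := norm_fst_le (x t₀ - y t₀)
    have h2 : ‖(x t₀).2 - (y t₀).2‖ ≤ ‖x t₀ - y t₀‖ := norm_snd_le (x t₀ - y t₀)
    have h3 := mul_le_mul_of_nonneg_left h2 hβ.le
    simp only [V]
    linarith
  have hfin := hlow.trans (hdec.trans
    (mul_le_mul_of_nonneg_left hup (Real.exp_pos (-c * (t - t₀))).le))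
  rw [mul_comm, ← le_div_iff₀ hmin] at hfin
  refine hfin.trans_eq ?_
  ring
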